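/- Conventions. A represented space is a set $X$ with a surjective partial map $\delta_X:\subseteq\mathbb{N}^{\mathbb{N}}\to X$; if $\delta_X(p)=x$, then $p$ is a name of $x$. A (multivalued) map $f$ between represented spaces is computable (continuous) if some computable (continuous) partial function on $\mathbb{N}^{\mathbb{N}}$ maps every name of every $x$ in its domain to a name of $f(x)$ (of an element of $f(x)$). A computable embedding is an injective computable map whose partial inverse is computable. $\mathcal{C}(X,Y)$ is the represented space of the continuous maps $X\to Y$, where a name of $f$ is a code of a continuous realizer of $f$ (a Kleene associate). $\mathbb{S}=\{0,1\}$ is Sierpiński space, where the zero sequence is the name of $0$ and all other sequences are names of $1$. $\mathcal{O}(X)$ is the final topology of $\delta_X$, where $U$ is represented by its characteristic function in $\mathcal{C}(X,\mathbb{S})$. $\mathcal{K}_-(X)$ is the set of the saturated compact sets $K\subseteq X$ (those that are the intersection of their open supersets), where $K$ is represented by the open set $\{U\in\mathcal{O}(X):K\subseteq U\}\in\mathcal{O}\mathcal{O}(X)$, and $\mathcal{A}_+(X)$ is the set of the closed sets $A\subseteq X$, where $A$ is represented by $\{U\in\mathcal{O}(X):A\cap U\neq\emptyset\}\in\mathcal{O}\mathcal{O}(X)$.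 A computable Kolmogorov space is a represented space $Y$ for which the neighborhood map $Y\to\mathcal{O}\mathcal{O}(Y)$, $y\mapsto\{U\in\mathcal{O}(Y):y\in U\}$ is a computable embedding. A map $B:Z\to\mathcal{O}(X)$ on a represented space $Z$ is a computable presubbase of $X$ if the transpose $X\to\mathcal{O}(Z)$, $x\mapsto\{z\in Z:x\in B_z\}$ is a well-defined computable embedding; it is a computable prebase of $X$ if, moreover, $X=\bigcup_{z\in Z}B_z$ and there is a computable multivalued map $R:\mathcal{K}_-(Z)\rightrightarrows\mathcal{A}_+(Z)$ with $\bigcap_{z\in K}B_z=\bigcup_{z\in A}B_z$ for all $K\in\mathcal{K}_-(Z)$ and $A\in R(K)$ (the empty intersection is $X$). Proposition 26 (Computable presubbases). Let $X$ be a represented space and let $Y$ be a computable Kolmogorov space. The following maps are computable presubbases of $\mathcal{O}(X)$, $\mathcal{O}(X)$, $\mathcal{K}_-(X)$, $\mathcal{A}_+(X)$ and $\mathcal{C}(X,Y)$, respectively: 1. $\mathcal{U}:X\to\mathcal{O}\mathcal{O}(X)$, $x\mapsto\{U\in\mathcal{O}(X):x\in U\}$; 2. $\mathcal{F}:\mathcal{K}_-(X)\to\mathcal{O}\mathcal{O}(X)$,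 $K\mapsto\{U\in\mathcal{O}(X):K\subseteq U\}$; 3. $\Box:\mathcal{O}(X)\to\mathcal{O}\mathcal{K}_-(X)$, $U\mapsto\{K\in\mathcal{K}_-(X):K\subseteq U\}$; 4. $\Diamond:\mathcal{O}(X)\to\mathcal{O}\mathcal{A}_+(X)$, $U\mapsto\{A\in\mathcal{A}_+(X):A\cap U\neq\emptyset\}$; 5. $\triangleright:\mathcal{K}_-(X)\times\mathcal{O}(Y)\to\mathcal{O}\mathcal{C}(X,Y)$, $(K,U)\mapsto\{f\in\mathcal{C}(X,Y):f(K)\subseteq U\}$. The maps $\mathcal{F}$ and $\Box$ are even computable prebases. -/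

import Mathlib

open scoped Topology

namespace TTE

universe u v w

/-! ### Computability on Baire space

Partial functionals on `ℕ → ℕ` are given by Kleene associates: `p` is read as a table that assigns
to an output position `n` and a finite prefix of the input either `0` (more input is needed) or
`v + 1` (the `n`-th output is `v`).  Every partial continuous functional has an extension of this
form, and the computable functionals are those with a computable associate. -/

/-- The code of the pair of an output position `n` and the first `k` values of the input `q`. -/
def query (q : ℕ → ℕ) (n k : ℕ) : ℕ :=
  Encodable.encode ((n, (List.range k).map q) : ℕ × List ℕ)

/-- The functional with associate `p` has on input `q` the `n`-th output `v`. -/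
def OutputsAt (p q : ℕ → ℕ) (n v : ℕ) : Prop :=
  ∃ k, p (query q n k) = v + 1 ∧ ∀ j < k, p (query q n j) = 0

/-- The functional with associate `p` is defined on `q` with value `r`. -/
def Applies (p q r : ℕ → ℕ) : Prop := ∀ n, OutputsAt p q n (r n)

theorem OutputsAt.unique {p q : ℕ → ℕ} {n v w : ℕ} (h : OutputsAt p q n v)
    (h' : OutputsAt p q n w) : v = w := by
  obtain ⟨k, hk, hk0⟩ := h
  obtain ⟨l, hl, hl0⟩ := h'
  rcases lt_trichotomy k l with hkl | hkl | hkl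
  · have := hl0 k hkl; omega
  · subst hkl; omega
  · have := hk0 l hkl; omega

theorem Applies.unique {p q r s : ℕ → ℕ} (h : Applies p q r) (h' : Applies p q s) : r = s :=
  funext fun n => (h n).unique (h' n)

theorem query_congr {q q' : ℕ → ℕ} {k : ℕ} (h : ∀ i < k, q' i = q i) {n j : ℕ} (hj : j ≤ k) :
    query q' n j = query q n j := by
  have : (List.range j).map q' = (List.range j).map q :=
    List.map_congr_left fun i hi => h i (lt_of_lt_of_le (List.mem_range.1 hi) hj)
  simp only [query, this]

theorem OutputsAt.finite {p q : ℕ → ℕ} {n v : ℕ} (h : OutputsAt p q n v) :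
    ∃ m, ∀ p' q' : ℕ → ℕ, (∀ i < m, p' i = p i) → (∀ i < m, q' i = q i) →
      OutputsAt p' q' n v := by
  obtain ⟨k, hk, hk0⟩ := h
  refine ⟨k + ∑ j ∈ Finset.range (k + 1), (query q n j + 1), fun p' q' hp hq => ?_⟩
  have hlt : ∀ j ≤ k, query q n j < k + ∑ j ∈ Finset.range (k + 1), (query q n j + 1) := by
    intro j hj
    have := Finset.single_le_sum (f := fun j => query q n j + 1) (fun i _ => Nat.zero_le _)
      (Finset.mem_range.2 (show j < k + 1 by omega))
    omega
  have hq' : ∀ j ≤ k, p' (query q' n j) = p (query q n j) := by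
    intro j hj
    rw [query_congr (q := q) (fun i hi => hq i (by omega)) hj]
    exact hp _ (hlt j hj)
  exact ⟨k, by rw [hq' k le_rfl, hk], fun j hj => by rw [hq' j hj.le, hk0 j hj]⟩

theorem exists_prefix {W : Set (ℕ → ℕ)} (hW : IsOpen W) {q : ℕ → ℕ} (hq : q ∈ W) :
    ∃ k, ∀ q' : ℕ → ℕ, (∀ i < k, q' i = q i) → q' ∈ W := by
  obtain ⟨t, ⟨x, k, rfl⟩, hqt, ht⟩ :=
    (PiNat.isTopologicalBasis_cylinders (fun _ : ℕ => ℕ)).exists_subset_of_mem_open hq hW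
  refine ⟨k, fun q' h => ht ?_⟩
  rw [PiNat.mem_cylinder_iff] at hqt ⊢
  intro i hi
  rw [h i hi, hqt i hi]

theorem isOpen_prefix (q : ℕ → ℕ) (k : ℕ) : IsOpen {q' : ℕ → ℕ | ∀ i < k, q' i = q i} := by
  have := PiNat.isOpen_cylinder (fun _ : ℕ => ℕ) q k
  rwa [show PiNat.cylinder (E := fun _ : ℕ => ℕ) q k = {q' : ℕ → ℕ | ∀ i < k, q' i = q i} from
    Set.ext fun q' => PiNat.mem_cylinder_iff] at this

/-- Every functional that is continuous on a set `D` has an associate. -/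
theorem exists_associate {D : Set (ℕ → ℕ)} {F : (ℕ → ℕ) → ℕ → ℕ} (hF : ContinuousOn F D) :
    ∃ p, ∀ q ∈ D, Applies p q (F q) := by
  classical
  let P : ℕ × List ℕ → ℕ → Prop := fun c v =>
    ∀ q ∈ D, (List.range c.2.length).map q = c.2 → F q c.1 = v
  let p : ℕ → ℕ := fun a =>
    match Encodable.decode (α := ℕ × List ℕ) a with
    | none => 0
    | some c => if h : ∃ v, P c v then h.choose + 1 else 0
  have hp : ∀ q n k, p (query q n k) =
      if h : ∃ v, P (n, (List.range k).map q) v then h.choose + 1 else 0 := by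
    intro q n k
    simp only [p, query, Encodable.encodek]
  refine ⟨p, fun q hq n => ?_⟩
  have hex : ∃ k, ∃ v, P (n, (List.range k).map q) v := by
    have hc : ContinuousOn (fun q => F q n) D := (continuous_apply n).comp_continuousOn hF
    obtain ⟨W, hW, hWD⟩ := continuousOn_iff'.1 hc {F q n} (isOpen_discrete _)
    have hqW : q ∈ W := by
      have : q ∈ (fun q => F q n) ⁻¹' {F q n} ∩ D := ⟨rfl, hq⟩
      rw [hWD] at this
      exact this.1
    obtain ⟨k, hk⟩ := exists_prefix hW hqW
    refine ⟨k, F q n, fun q' hq' h => ?_⟩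
    have h2 : q' ∈ W := by
      refine hk q' fun i hi => ?_
      simp only [List.length_map, List.length_range] at h
      exact List.map_inj_left.1 h i (List.mem_range.2 hi)
    have : q' ∈ W ∩ D := ⟨h2, hq'⟩
    rw [← hWD] at this
    exact this.1
  refine ⟨Nat.find hex, ?_, fun j hj => ?_⟩
  · rw [hp, dif_pos (Nat.find_spec hex)]
    have := (Nat.find_spec hex).choose_spec q hq (by simp)
    exact congrArg (· + 1) this.symm
  · rw [hp, dif_neg (Nat.find_min hex hj)]

/-! ### Represented spaces -/

/-- A represented space: a surjective partial map `δ` from Baire space to `X`, given by its graph;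
`Names p x` says `δ p = x`. -/
class RepresentedSpace (X : Type u) where
  Names : (ℕ → ℕ) → X → Prop
  unique : ∀ {p x y}, Names p x → Names p y → x = y
  surj : ∀ x, ∃ p, Names p x

open RepresentedSpace (Names)

/-- The domain of the representation. -/
def dom (X : Type u) [RepresentedSpace X] : Set (ℕ → ℕ) := {p | ∃ x : X, Names p x}

/-- The representation as a map on its domain. -/
noncomputable def delta (X : Type u) [RepresentedSpace X] (p : dom X) : X := p.2.choose

/-- The final topology on a represented space. -/
@[reducible] noncomputable def finalTopology (X : Type u) [RepresentedSpace X] : TopologicalSpace X :=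
  TopologicalSpace.coinduced (delta X) inferInstance

theorem delta_eq {X : Type u} [RepresentedSpace X] {p : ℕ → ℕ} {x : X} (h : Names p x) :
    delta X ⟨p, x, h⟩ = x :=
  RepresentedSpace.unique (Exists.choose_spec (⟨x, h⟩ : ∃ x : X, Names p x)) h

/-- Openness in the final topology in terms of finite prefixes of names. -/
theorem isOpen_final_iff {X : Type u} [RepresentedSpace X] {U : Set X} :
    IsOpen[finalTopology X] U ↔ ∀ q x, Names q x → x ∈ U →
      ∃ k, ∀ q' x', Names q' x' → (∀ i < k, q' i = q i) → x' ∈ U := by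
  rw [finalTopology, isOpen_coinduced, isOpen_induced_iff]
  constructor
  · rintro ⟨W, hW, hWU⟩ q x hq hx
    have hmem : ∀ q x, (h : Names q x) → (q ∈ W ↔ x ∈ U) := fun q x h => by
      have : (⟨q, x, h⟩ : dom X) ∈ Subtype.val ⁻¹' W ↔ (⟨q, x, h⟩ : dom X) ∈ delta X ⁻¹' U := by
        rw [hWU]
      simpa [delta_eq h] using this
    obtain ⟨k, hk⟩ := exists_prefix hW ((hmem q x hq).2 hx)
    exact ⟨k, fun q' x' h' hi => (hmem q' x' h').1 (hk q' hi)⟩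
  · intro H
    refine ⟨{q | ∃ k, ∀ q' x', Names q' x' → (∀ i < k, q' i = q i) → x' ∈ U}, ?_, ?_⟩
    · rw [isOpen_iff_mem_nhds]
      rintro q ⟨k, hk⟩
      refine Filter.mem_of_superset ((isOpen_prefix q k).mem_nhds fun i _ => rfl) ?_
      intro q₁ h₁
      exact ⟨k, fun q' x' h' hi => hk q' x' h' fun i hik => (hi i hik).trans (h₁ i hik)⟩
    · ext ⟨q, x, hq⟩
      simp only [Set.mem_preimage, Set.mem_ofPred_eq, delta_eq hq]
      exact ⟨fun ⟨k, hk⟩ => hk q x hq fun _ _ => rfl, H q x hq⟩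

/-- `p` is an associate of a realizer of the multivalued map `f`. -/
def RealizesMulti {X : Type u} {Y : Type v} [RepresentedSpace X] [RepresentedSpace Y]
    (p : ℕ → ℕ) (f : X → Set Y) : Prop :=
  ∀ q x, Names q x → ∃ r, Applies p q r ∧ ∃ y ∈ f x, Names r y

/-- `p` is an associate of a realizer of `f`. -/
def Realizes {X : Type u} {Y : Type v} [RepresentedSpace X] [RepresentedSpace Y]
    (p : ℕ → ℕ) (f : X → Y) : Prop :=
  ∀ q x, Names q x → ∃ r, Applies p q r ∧ Names r (f x)

/-- A computable map between represented spaces. -/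
def ComputableMap {X : Type u} {Y : Type v} [RepresentedSpace X] [RepresentedSpace Y]
    (f : X → Y) : Prop := ∃ p, Computable p ∧ Realizes p f

/-- A computable multivalued map with domain `X` (in particular, all `f x` are nonempty). -/
def ComputableMulti {X : Type u} {Y : Type v} [RepresentedSpace X] [RepresentedSpace Y]
    (f : X → Set Y) : Prop := ∃ p, Computable p ∧ RealizesMulti p f

/-- A computable embedding: an injective computable map with computable partial inverse. -/
def ComputableEmbedding {X : Type u} {Y : Type v} [RepresentedSpace X] [RepresentedSpace Y]
    (f : X → Y) : Prop :=
  Function.Injective f ∧ ComputableMap f ∧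
    ∃ p, Computable p ∧ ∀ q x, Names q (f x) → ∃ r, Applies p q r ∧ Names r x

/-- A map is continuous, in the sense of represented spaces, if it has a continuous realizer. -/
def HasContinuousRealizer {X : Type u} {Y : Type v} [RepresentedSpace X] [RepresentedSpace Y]
    (f : X → Y) : Prop :=
  ∃ F : (ℕ → ℕ) → ℕ → ℕ, ContinuousOn F (dom X) ∧ ∀ q x, Names q x → Names (F q) (f x)

/-! ### Constructions of represented spaces -/

/-- The representation that an injection into a represented space induces. -/
@[reducible] def RepresentedSpace.induced {S : Type u} {Z : Type v} [RepresentedSpace Z]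
    (e : S → Z) (he : Function.Injective e) : RepresentedSpace S where
  Names p s := Names p (e s)
  unique h h' := he (RepresentedSpace.unique h h')
  surj s := RepresentedSpace.surj (e s)

/-- The product: a name of `(x, y)` is a name of `x` interleaved with a name of `y`. -/
instance {X : Type u} {Y : Type v} [RepresentedSpace X] [RepresentedSpace Y] :
    RepresentedSpace (X × Y) where
  Names p z := Names (fun n => p (2 * n)) z.1 ∧ Names (fun n => p (2 * n + 1)) z.2
  unique h h' := Prod.ext (RepresentedSpace.unique h.1 h'.1) (RepresentedSpace.unique h.2 h'.2)
  surj z := by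
    obtain ⟨p, hp⟩ := RepresentedSpace.surj z.1
    obtain ⟨q, hq⟩ := RepresentedSpace.surj z.2
    refine ⟨fun n => if n % 2 = 0 then p (n / 2) else q (n / 2), ?_, ?_⟩
    · convert hp using 2 with n
      simp
    · convert hq using 2 with n
      have h1 : (2 * n + 1) % 2 = 1 := by omega
      have h2 : (2 * n + 1) / 2 = n := by omega
      simp [h1, h2]

/-- Sierpiński space, with truth values as points. -/
def Sierpinski : Type := Prop

/-- The zero sequence is the name of the bottom element, all other sequences name the top. -/
instance : RepresentedSpace Sierpinski where
  Names p (s : Prop) := s ↔ ∃ n, p n ≠ 0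
  unique h h' := propext (h.trans h'.symm)
  surj s := by
    rcases Classical.em s with hs | hs
    · exact ⟨fun _ => 1, iff_of_true hs ⟨0, one_ne_zero⟩⟩
    · exact ⟨fun _ => 0, iff_of_false hs fun ⟨_, h⟩ => h rfl⟩

/-- The space of continuous maps `X → Y`. -/
def ContFun (X : Type u) (Y : Type v) [RepresentedSpace X] [RepresentedSpace Y] :
    Type (max u v) := {f : X → Y // HasContinuousRealizer f}

/-- A name of a continuous map is an associate of one of its realizers. -/
instance {X : Type u} {Y : Type v} [RepresentedSpace X] [RepresentedSpace Y] :
    RepresentedSpace (ContFun X Y) where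
  Names p f := Realizes p f.1
  unique {p f g} h h' := Subtype.ext <| funext fun x => by
    obtain ⟨q, hq⟩ := RepresentedSpace.surj x
    obtain ⟨r, hr, hrx⟩ := h q x hq
    obtain ⟨s, hs, hsx⟩ := h' q x hq
    rw [hr.unique hs] at hrx
    exact RepresentedSpace.unique hrx hsx
  surj f := by
    obtain ⟨F, hF, hFf⟩ := f.2
    obtain ⟨p, hp⟩ := exists_associate hF
    exact ⟨p, fun q x hq => ⟨F q, hp q ⟨x, hq⟩, hFf q x hq⟩⟩

/-- The hyperspace `𝒪(X)` of the open subsets of `X` in the final topology. -/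
def Opens (X : Type u) [RepresentedSpace X] : Type u := {U : Set X // IsOpen[finalTopology X] U}

/-- The characteristic function of a set. -/
def charFun {X : Type u} (U : Set X) : X → Sierpinski := fun x => x ∈ U

/-- The characteristic function of an open set is continuous. -/
theorem charFun_continuous {X : Type u} [RepresentedSpace X] (U : Opens X) :
    HasContinuousRealizer (charFun U.1) := by
  classical
  let G : ℕ → (ℕ → ℕ) → Prop := fun n q =>
    ∀ q' (x' : X), Names q' x' → (∀ i < n, q' i = q i) → x' ∈ U.1
  refine ⟨fun q n => if G n q then 1 else 0, Continuous.continuousOn ?_, fun q x hq => ?_⟩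
  · refine continuous_pi fun n => IsLocallyConstant.continuous ?_
    rw [IsLocallyConstant.iff_exists_open]
    refine fun q => ⟨_, isOpen_prefix q n, fun i _ => rfl, fun q₁ h₁ => ?_⟩
    have : G n q₁ ↔ G n q := by
      refine forall₃_congr fun q' x' _ => ?_
      refine imp_congr_left (forall₂_congr fun i hi => ?_)
      rw [h₁ i hi]
    simp only [this]
  · change x ∈ U.1 ↔ ∃ n, (if G n q then 1 else 0) ≠ 0
    constructor
    · intro hx
      obtain ⟨k, hk⟩ := isOpen_final_iff.1 U.2 q x hq hx
      exact ⟨k, by rw [if_pos (show G k q from hk)]; exact one_ne_zero⟩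
    · rintro ⟨n, hn⟩
      have : G n q := by
        by_contra h
        exact hn (if_neg h)
      exact this q x hq fun _ _ => rfl

/-- The characteristic function of an open set as a continuous map into Sierpiński space. -/
def Opens.char {X : Type u} [RepresentedSpace X] (U : Opens X) : ContFun X Sierpinski :=
  ⟨charFun U.1, charFun_continuous U⟩

theorem Opens.char_injective {X : Type u} [RepresentedSpace X] :
    Function.Injective (Opens.char (X := X)) := by
  intro U V h
  refine Subtype.ext (Set.ext fun x => ?_)
  exact iff_of_eq (congrFun (congrArg Subtype.val h) x)

/-- Open sets are represented via their characteristic functions. -/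
instance {X : Type u} [RepresentedSpace X] : RepresentedSpace (Opens X) :=
  RepresentedSpace.induced Opens.char Opens.char_injective

/-- Membership in an open set depends on a finite prefix of the names. -/
theorem Opens.finite {X : Type u} [RepresentedSpace X] {p q : ℕ → ℕ} {U : Opens X} {x : X}
    (hp : Names p U) (hq : Names q x) (hx : x ∈ U.1) :
    ∃ m, ∀ p' q' (U' : Opens X) (x' : X), Names p' U' → Names q' x' →
      (∀ i < m, p' i = p i) → (∀ i < m, q' i = q i) → x' ∈ U'.1 := by
  obtain ⟨r, hr, hrx⟩ := hp q x hq
  obtain ⟨n, hn⟩ := (show x ∈ U.1 ↔ ∃ n, r n ≠ 0 from hrx).1 hx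
  obtain ⟨m, hm⟩ := (hr n).finite
  refine ⟨m, fun p' q' U' x' hp' hq' h₁ h₂ => ?_⟩
  obtain ⟨r', hr', hrx'⟩ := hp' q' x' hq'
  refine (show x' ∈ U'.1 ↔ ∃ n, r' n ≠ 0 from hrx').2 ⟨n, ?_⟩
  rwa [(hr' n).unique (hm p' q' h₁ h₂)]

theorem isOpen_traceSet {X : Type u} [RepresentedSpace X] (A : Set X) :
    IsOpen[finalTopology (Opens X)] {U : Opens X | (A ∩ U.1).Nonempty} := by
  rw [isOpen_final_iff]
  rintro p U hp ⟨x, hxA, hxU⟩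
  obtain ⟨q, hq⟩ := RepresentedSpace.surj x
  obtain ⟨m, hm⟩ := Opens.finite hp hq hxU
  exact ⟨m, fun p' U' hp' h => ⟨x, hxA, hm p' q U' x hp' hq h fun _ _ => rfl⟩⟩

theorem isOpen_filterSet {X : Type u} [RepresentedSpace X] {K : Set X}
    (hK : @IsCompact X (finalTopology X) K) :
    IsOpen[finalTopology (Opens X)] {U : Opens X | K ⊆ U.1} := by
  rw [isOpen_final_iff]
  intro p U hp hKU
  by_contra! H
  choose P V hP hPp hV using H
  simp only [Set.mem_ofPred_eq] at hV hKU
  let A : ℕ → Set X := fun k => {x | x ∈ U.1 ∧ ∀ n, k ≤ n → x ∈ (V n).1}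
  have hA : ∀ k, IsOpen[finalTopology X] (A k) := by
    intro k
    rw [isOpen_final_iff]
    rintro q x hq ⟨hxU, hxV⟩
    obtain ⟨m, hm⟩ := Opens.finite hp hq hxU
    have hfin : ∀ n, ∃ l, k ≤ n → ∀ q' x', Names q' x' → (∀ i < l, q' i = q i) → x' ∈ (V n).1 := by
      intro n
      by_cases hn : k ≤ n
      · obtain ⟨l, hl⟩ := isOpen_final_iff.1 (V n).2 q x hq (hxV n hn)
        exact ⟨l, fun _ => hl⟩
      · exact ⟨0, fun h => absurd h hn⟩
    choose L hL using hfin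
    refine ⟨m + ∑ n ∈ Finset.range m, L n, fun q' x' hq' hi => ⟨?_, fun n hn => ?_⟩⟩
    · exact hm p q' U x' hp hq' (fun _ _ => rfl) fun i him => hi i (by omega)
    · rcases lt_or_ge n m with h | h
      · have := Finset.single_le_sum (f := L) (fun i _ => Nat.zero_le _) (Finset.mem_range.2 h)
        exact hL n hn q' x' hq' fun i hil => hi i (by omega)
      · exact hm (P n) q' (V n) x' (hP n) hq' (fun i him => hPp n i (by omega))
          fun i him => hi i (by omega)
  have hmono : Monotone A := fun k l hkl x hx => ⟨hx.1, fun n hn => hx.2 n (hkl.trans hn)⟩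
  have hcov : K ⊆ ⋃ k, A k := by
    intro x hx
    obtain ⟨q, hq⟩ := RepresentedSpace.surj x
    obtain ⟨m, hm⟩ := Opens.finite hp hq (hKU hx)
    exact Set.mem_iUnion.2 ⟨m, hKU hx, fun n hn => hm (P n) q (V n) x (hP n) hq
      (fun i hi => hPp n i (by omega)) fun _ _ => rfl⟩
  obtain ⟨k, hk⟩ := @IsCompact.elim_directed_cover X (finalTopology X) K ℕ _ hK A hA hcov
    (hmono.directed_le)
  exact hV k fun x hx => (hk hx).2 k le_rfl

/-- The hyperspace `𝒦₋(X)` of the saturated compact subsets of `X`, where a set is saturated if it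
is the intersection of its open supersets. -/
def CompactSets (X : Type u) [RepresentedSpace X] : Type u :=
  {K : Set X // @IsCompact X (finalTopology X) K ∧
    K = ⋂₀ {U | IsOpen[finalTopology X] U ∧ K ⊆ U}}

/-- The open set `{U | K ⊆ U}`; its characteristic function is universal quantification
over `K`. -/
def CompactSets.filter {X : Type u} [RepresentedSpace X] (K : CompactSets X) : Opens (Opens X) :=
  ⟨{U | K.1 ⊆ U.1}, isOpen_filterSet K.2.1⟩

theorem CompactSets.filter_injective {X : Type u} [RepresentedSpace X] :
    Function.Injective (CompactSets.filter (X := X)) := by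
  intro K L h
  have h' : ∀ U, IsOpen[finalTopology X] U → (K.1 ⊆ U ↔ L.1 ⊆ U) := fun U hU =>
    Set.ext_iff.1 (congrArg Subtype.val h) (⟨U, hU⟩ : Opens X)
  refine Subtype.ext ?_
  rw [K.2.2, L.2.2]
  congr 1
  ext U
  exact and_congr_right (h' U)

/-- Saturated compact sets are represented via universal quantification over them. -/
instance {X : Type u} [RepresentedSpace X] : RepresentedSpace (CompactSets X) :=
  RepresentedSpace.induced CompactSets.filter CompactSets.filter_injective

/-- The hyperspace `𝒜₊(X)` of the closed subsets of `X`, with positive information. -/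
def ClosedSets (X : Type u) [RepresentedSpace X] : Type u :=
  {A : Set X // @IsClosed X (finalTopology X) A}

/-- The open set `{U | A ∩ U ≠ ∅}`; its characteristic function is existential quantification
over `A`. -/
def ClosedSets.trace {X : Type u} [RepresentedSpace X] (A : ClosedSets X) : Opens (Opens X) :=
  ⟨{U | (A.1 ∩ U.1).Nonempty}, isOpen_traceSet A.1⟩

theorem ClosedSets.trace_injective {X : Type u} [RepresentedSpace X] :
    Function.Injective (ClosedSets.trace (X := X)) := by
  have key : ∀ A B : ClosedSets X, A.trace = B.trace → A.1 ⊆ B.1 := by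
    intro A B h x hx
    by_contra hxB
    have hB : IsOpen[finalTopology X] (B.1)ᶜ := (@isOpen_compl_iff X _ (finalTopology X)).2 B.2
    have := (Set.ext_iff.1 (congrArg Subtype.val h) (⟨_, hB⟩ : Opens X)).1 ⟨x, hx, hxB⟩
    obtain ⟨y, hy, hy'⟩ := this
    exact hy' hy
  exact fun A B h => Subtype.ext (Set.Subset.antisymm (key A B h) (key B A h.symm))

/-- Closed sets are represented via existential quantification over them. -/
instance {X : Type u} [RepresentedSpace X] : RepresentedSpace (ClosedSets X) :=
  RepresentedSpace.induced ClosedSets.trace ClosedSets.trace_injective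

/-! ### Computable Kolmogorov spaces, presubbases and prebases

Families of open sets are written as families of sets; that their members are open is part of the
definitions. -/

/-- The transpose `x ↦ {y | x ∈ B y}` of a family of sets. -/
def transpose {X : Type u} {Y : Type v} (B : Y → Set X) : X → Set Y := fun x => {y | x ∈ B y}

/-- A map into the power set of `Z` takes values in `𝒪(Z)` and is a computable embedding of `X`
into `𝒪(Z)`. -/
def EmbedsInOpens {X : Type u} {Z : Type v} [RepresentedSpace X] [RepresentedSpace Z]
    (f : X → Set Z) : Prop :=
  ∃ h : ∀ x, IsOpen[finalTopology Z] (f x),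
    ComputableEmbedding (Y := Opens Z) (fun x => ⟨f x, h x⟩)

/-- `B : Y → 𝒪(X)` is a computable presubbase of `X`. -/
def IsComputablePresubbase {X : Type u} {Y : Type v} [RepresentedSpace X] [RepresentedSpace Y]
    (B : Y → Set X) : Prop :=
  (∀ y, IsOpen[finalTopology X] (B y)) ∧ EmbedsInOpens (transpose B)

/-- `B : Y → 𝒪(X)` is a computable prebase of `X`. -/
def IsComputablePrebase {X : Type u} {Y : Type v} [RepresentedSpace X] [RepresentedSpace Y]
    (B : Y → Set X) : Prop :=
  IsComputablePresubbase B ∧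
  (∃ R : CompactSets Y → Set (ClosedSets Y), ComputableMulti R ∧
    ∀ K, ∀ A ∈ R K, ⋂ y ∈ K.1, B y = ⋃ y ∈ A.1, B y) ∧
  ⋃ y, B y = Set.univ

/-- The neighborhood map. -/
def nhdMap (X : Type u) [RepresentedSpace X] (x : X) : Set (Opens X) := {U | x ∈ U.1}

/-- The filter map. -/
def filterMap (X : Type u) [RepresentedSpace X] (K : CompactSets X) : Set (Opens X) :=
  {U | K.1 ⊆ U.1}

/-- The box map. -/
def boxMap (X : Type u) [RepresentedSpace X] (U : Opens X) : Set (CompactSets X) :=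
  {K | K.1 ⊆ U.1}

/-- The diamond map. -/
def diamondMap (X : Type u) [RepresentedSpace X] (U : Opens X) : Set (ClosedSets X) :=
  {A | (A.1 ∩ U.1).Nonempty}

/-- The compact-open subbase. -/
def compactOpenMap (X : Type u) (Y : Type v) [RepresentedSpace X] [RepresentedSpace Y]
    (z : CompactSets X × Opens Y) : Set (ContFun X Y) := {f | f.1 '' z.1.1 ⊆ z.2.1}

/-- A computable Kolmogorov space: the neighborhood map `Y → 𝒪𝒪(Y)` is a computable embedding. -/
def IsComputableKolmogorov (Y : Type u) [RepresentedSpace Y] : Prop := EmbedsInOpens (nhdMap Y)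

end TTE

open TTE

/-! Membership can be read from either side, and each claim is an instance of this duality. For
`nhdMap`, `boxMap` and `diamondMap` the transpose sends a point to the very open set through which
it is represented, so names do not change and the identity realizes both directions. The transpose
of `filterMap` is `boxMap`, which is computable by evaluation; `U` is recovered from its box because
`x ∈ U` iff the saturation of `{x}` lies in `U`. The transpose of `compactOpenMap` is computable
because `f(K) ⊆ U` iff `K ⊆ f⁻¹(U)`, and preimages arise by composition. Conversely, testing `f` on
the saturation of `{x}` and a variable `U` yields the neighborhood filter of `f(x)`, from which the
Kolmogorov hypothesis computes `f(x)`.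

For the prebases, compact intersections of members are again members: filters intersect to the
filter of the saturated union (`isCompact_biUnion`), and boxes intersect to the box of the
intersection, which is open by `realizes_biInter`. So the closure of a single index serves as the
value of `R`.

All realizers are lambda terms: `Comp` is closed under pairing, application (`Comp.app`) and
abstraction (`Comp.abs`). Tables are handled only in the proofs of these closure properties, where
`Tracks` allows several partial computations to be awaited on one long input prefix. -/

namespace TTE

open Filter
open TTE.RepresentedSpace (Names)

universe u v

/-! ### Finite approximations of functionals -/

/-- The list of the first `k` values of a sequence. -/
def pre (q : ℕ → ℕ) (k : ℕ) : List ℕ := (List.range k).map q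

@[simp] theorem length_pre (q : ℕ → ℕ) (k : ℕ) : (pre q k).length = k := by simp [pre]

theorem pre_succ (q : ℕ → ℕ) (k : ℕ) : pre q (k + 1) = pre q k ++ [q k] := by
  simp [pre, List.range_succ]

@[simp] theorem getElem_pre (q : ℕ → ℕ) (k n : ℕ) (h : n < (pre q k).length) :
    (pre q k)[n] = q n := by simp [pre]

theorem query_eq (q : ℕ → ℕ) (n k : ℕ) : query q n k = Encodable.encode (n, pre q k) := rfl

theorem getD_pre (q : ℕ → ℕ) {k n : ℕ} (h : n < k) : (pre q k).getD n 0 = q n := by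
  simp [List.getD_eq_getElem?_getD, h]

/-- `T l n` is the guess at the `n`-th output made from the prefix `l` of the input, where `0` means
that the prefix is too short and `v + 1` stands for the value `v`; on prefixes of `e` all guesses are
right, and long prefixes give a value. -/
def Tracks (T : List ℕ → ℕ → ℕ) (e r : ℕ → ℕ) : Prop :=
  ∀ n, (∀ k, T (pre e k) n = 0 ∨ T (pre e k) n = r n + 1) ∧ ∀ᶠ k in atTop, T (pre e k) n = r n + 1

/-- The associate given by a table of guesses. -/
def associate (T : List ℕ → ℕ → ℕ) (a : ℕ) : ℕ :=
  (Encodable.decode (α := ℕ × List ℕ) a).elim 0 fun c => T c.2 c.1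

theorem associate_query (T : List ℕ → ℕ → ℕ) (q : ℕ → ℕ) (n k : ℕ) :
    associate T (query q n k) = T (pre q k) n := by
  simp [associate, query, pre]

/-- An associate is read at its first nonzero entry; if all nonzero entries are right, so is that
one. -/
theorem outputsAt_of_first {p q : ℕ → ℕ} {n v : ℕ}
    (h₁ : ∀ k, p (query q n k) = 0 ∨ p (query q n k) = v + 1) (h₂ : ∃ k, p (query q n k) = v + 1) :
    OutputsAt p q n v := by
  classical
  refine ⟨Nat.find h₂, Nat.find_spec h₂, fun j hj => ?_⟩
  exact (h₁ j).resolve_right (Nat.find_min h₂ hj)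

theorem Tracks.applies {T : List ℕ → ℕ → ℕ} {e r : ℕ → ℕ} (h : Tracks T e r) :
    Applies (associate T) e r := fun n =>
  outputsAt_of_first (fun k => by rw [associate_query]; exact (h n).1 k)
    ((h n).2.exists.imp fun k hk => by rw [associate_query, hk])

theorem computable_associate {T : List ℕ → ℕ → ℕ} (hT : Computable₂ T) :
    Computable (associate T) := by
  refine (Computable.option_casesOn (g := fun (_ : ℕ) (c : ℕ × List ℕ) => T c.2 c.1) Computable.decode
    (Computable.const 0) ?_).of_eq fun a => ?_
  · exact (hT.comp (Computable.snd.comp Computable.snd) (Computable.fst.comp Computable.snd)).to₂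
  · unfold associate; cases (Encodable.decode a : Option (ℕ × List ℕ)) <;> rfl

/-! ### Bounded search -/

/-- The first nonzero value among `g 0, …, g N`, or `0` if there is none. -/
def firstNonzero (g : ℕ → ℕ) (N : ℕ) : ℕ :=
  Nat.rec (g 0) (fun k s => Nat.casesOn s (g (k + 1)) Nat.succ) N

theorem firstNonzero_eq_zero {g : ℕ → ℕ} {N : ℕ} (h : ∀ j ≤ N, g j = 0) :
    firstNonzero g N = 0 := by
  induction N with
  | zero => exact h 0 le_rfl
  | succ N ih =>
    have h0 := ih fun j hj => h j (by omega)
    change Nat.casesOn (firstNonzero g N) (g (N + 1)) Nat.succ = 0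
    rw [h0]
    exact h _ le_rfl

theorem firstNonzero_eq {g : ℕ → ℕ} {k N : ℕ} (hk : g k ≠ 0) (h : ∀ j < k, g j = 0) (hkN : k ≤ N) :
    firstNonzero g N = g k := by
  induction N with
  | zero =>
    obtain rfl : k = 0 := by omega
    rfl
  | succ N ih =>
    change Nat.casesOn (firstNonzero g N) (g (N + 1)) Nat.succ = g k
    rcases Nat.lt_or_ge N k with hN | hN
    · obtain rfl : k = N + 1 := by omega
      rw [firstNonzero_eq_zero fun j (hj : j ≤ N) => h j (by omega)]
      exact rfl
    · rw [ih hN]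
      obtain ⟨v, hv⟩ := Nat.exists_eq_succ_of_ne_zero hk
      rw [hv]

/-- The bound only decides whether the search succeeds: a nonzero result is the first nonzero value
of the whole sequence, whatever `N` is. -/
theorem firstNonzero_cases (g : ℕ → ℕ) (N : ℕ) :
    firstNonzero g N = 0 ∨ ∃ k, g k ≠ 0 ∧ (∀ j < k, g j = 0) ∧ firstNonzero g N = g k := by
  classical
  by_cases h : ∃ k, k ≤ N ∧ g k ≠ 0
  · have hs := Nat.find_spec h
    have hm : ∀ j < Nat.find h, g j = 0 := fun j hj => by
      have := Nat.find_min h hj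
      by_contra hj0
      exact this ⟨by omega, hj0⟩
    exact Or.inr ⟨_, hs.2, hm, firstNonzero_eq hs.2 hm hs.1⟩
  · push Not at h
    exact Or.inl (firstNonzero_eq_zero h)

theorem computable_firstNonzero {α : Type*} [Primcodable α] {g : α → ℕ → ℕ} {N : α → ℕ}
    (hg : Computable₂ g) (hN : Computable N) : Computable fun a => firstNonzero (g a) (N a) := by
  refine Computable.nat_rec (h := fun a (s : ℕ × ℕ) => Nat.casesOn s.2 (g a (s.1 + 1)) Nat.succ) hN
    (hg.comp Computable.id (Computable.const 0)) ?_
  refine (Computable.nat_casesOn (α := α × (ℕ × ℕ)) (g := fun c => g c.1 (c.2.1 + 1)) (h := fun _ v => Nat.succ v)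
    (Computable.snd.comp Computable.snd) ?_ ?_).to₂
  · exact hg.comp Computable.fst (Computable.succ.comp (Computable.fst.comp Computable.snd))
  · exact (Computable.succ.comp Computable.snd).to₂

/-! ### Computable relations between inputs and outputs -/

/-- Some computable functional maps `e` to `r` whenever `Φ e r`. -/
def Comp (Φ : (ℕ → ℕ) → (ℕ → ℕ) → Prop) : Prop :=
  ∃ T, Computable₂ T ∧ ∀ e r, Φ e r → Tracks T e r

theorem Comp.exists_associate {Φ : (ℕ → ℕ) → (ℕ → ℕ) → Prop} (h : Comp Φ) :
    ∃ p, Computable p ∧ ∀ e r, Φ e r → Applies p e r := by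
  obtain ⟨T, hT, hΦ⟩ := h
  exact ⟨associate T, computable_associate hT, fun e r her => (hΦ e r her).applies⟩

theorem Comp.mono {Φ Ψ : (ℕ → ℕ) → (ℕ → ℕ) → Prop} (h : Comp Ψ) (hΦ : ∀ e r, Φ e r → Ψ e r) :
    Comp Φ := by
  obtain ⟨T, hT, hΨ⟩ := h
  exact ⟨T, hT, fun e r her => hΨ e r (hΦ e r her)⟩

/-- A computable total functional. -/
def CompFun (F : (ℕ → ℕ) → ℕ → ℕ) : Prop := Comp fun e r => r = F e

/-- A functional that copies the entries at positions given by a primitive recursive function. -/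
theorem compFun_reindex {s : ℕ → ℕ} (hs : Primrec s) : CompFun fun e n => e (s n) := by
  refine ⟨fun l n => ((l[s n]?).map Nat.succ).getD 0, ?_, ?_⟩
  · have h : Computable₂ fun (l : List ℕ) (n : ℕ) => l[s n]? :=
      (Computable.list_getElem?.comp Computable.fst (hs.to_comp.comp Computable.snd)).to₂
    exact (Computable.option_getD (Computable.option_map h (Computable.succ.comp Computable.snd).to₂)
      (Computable.const 0)).to₂
  · rintro e _ rfl n
    refine ⟨fun k => ?_, eventually_atTop.2 ⟨s n + 1, fun k hk => ?_⟩⟩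
    · by_cases h : s n < k <;> simp [h]
    · have h : s n < k := hk
      simp [h]

theorem compFun_id : CompFun fun e => e := compFun_reindex Primrec.id

theorem compFun_const {p : ℕ → ℕ} (hp : Computable p) : CompFun fun _ => p := by
  refine ⟨fun _ n => p n + 1, (Computable.succ.comp (hp.comp Computable.snd)).to₂, ?_⟩
  rintro e _ rfl n
  simp

/-- The first component of an interleaved pair of sequences. -/
def fstSeq (e : ℕ → ℕ) : ℕ → ℕ := fun n => e (2 * n)

/-- The second component of an interleaved pair of sequences. -/
def sndSeq (e : ℕ → ℕ) : ℕ → ℕ := fun n => e (2 * n + 1)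

/-- Two sequences, interleaved. -/
def pairSeq (p q : ℕ → ℕ) : ℕ → ℕ := fun n => if n % 2 = 0 then p (n / 2) else q (n / 2)

@[simp] theorem fstSeq_pairSeq (p q : ℕ → ℕ) : fstSeq (pairSeq p q) = p := by
  funext n
  simp [fstSeq, pairSeq]

@[simp] theorem sndSeq_pairSeq (p q : ℕ → ℕ) : sndSeq (pairSeq p q) = q := by
  funext n
  have h1 : (2 * n + 1) % 2 = 1 := by omega
  have h2 : (2 * n + 1) / 2 = n := by omega
  simp [sndSeq, pairSeq, h1, h2]

theorem compFun_fst : CompFun fstSeq := compFun_reindex Primrec.nat_double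

theorem compFun_snd : CompFun sndSeq := compFun_reindex Primrec.nat_double_succ

theorem computable_even : Computable fun n : ℕ => decide (n % 2 = 0) :=
  ((Primrec.eq (α := ℕ)).comp (Primrec.nat_mod.comp Primrec.id (Primrec.const 2))
    (Primrec.const 0)).decide.to_comp

theorem computable_half : Computable fun n : ℕ => n / 2 :=
  (Primrec.nat_div.comp Primrec.id (Primrec.const 2)).to_comp

theorem Comp.pair {Φ Ψ : (ℕ → ℕ) → (ℕ → ℕ) → Prop} (hΦ : Comp Φ) (hΨ : Comp Ψ) :
    Comp fun e r => ∃ p q, Φ e p ∧ Ψ e q ∧ r = pairSeq p q := by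
  obtain ⟨S, hS, hSΦ⟩ := hΦ
  obtain ⟨T, hT, hTΨ⟩ := hΨ
  refine ⟨fun l n => bif decide (n % 2 = 0) then S l (n / 2) else T l (n / 2), ?_, ?_⟩
  · have h : Computable fun c : List ℕ × ℕ => c.2 / 2 := computable_half.comp Computable.snd
    exact (Computable.cond (computable_even.comp Computable.snd) (hS.comp Computable.fst h)
      (hT.comp Computable.fst h)).to₂
  · rintro e _ ⟨p, q, hp, hq, rfl⟩ n
    by_cases hn : n % 2 = 0
    · simpa [pairSeq, hn] using hSΦ e p hp (n / 2)
    · simpa [pairSeq, hn] using hTΨ e q hq (n / 2)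

/-! ### Application -/

/-- The first `k` outputs, provided that the prefix `l` of the input determines them. -/
def outputs (T : List ℕ → ℕ → ℕ) (l : List ℕ) (k : ℕ) : Option (List ℕ) :=
  Nat.rec (some [])
    (fun i s => s.bind fun m => Nat.casesOn (T l i) none fun v => some (m ++ [v])) k

theorem outputs_succ (T : List ℕ → ℕ → ℕ) (l : List ℕ) (k : ℕ) :
    outputs T l (k + 1) =
      (outputs T l k).bind fun m => Nat.casesOn (T l k) none fun v => some (m ++ [v]) := rfl

theorem Tracks.outputs_cases {T : List ℕ → ℕ → ℕ} {e q : ℕ → ℕ} (h : Tracks T e q) (N k : ℕ) :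
    outputs T (pre e N) k = none ∨ outputs T (pre e N) k = some (pre q k) := by
  induction k with
  | zero => exact Or.inr rfl
  | succ k ih =>
    rw [outputs_succ, pre_succ]
    rcases ih with ih | ih
    · simp [ih]
    · rcases (h k).1 N with h | h <;> simp [ih, h]

theorem Tracks.eventually_outputs {T : List ℕ → ℕ → ℕ} {e q : ℕ → ℕ} (h : Tracks T e q) (k : ℕ) :
    ∀ᶠ N in atTop, outputs T (pre e N) k = some (pre q k) := by
  induction k with
  | zero => exact Eventually.of_forall fun N => rfl
  | succ k ih =>
    filter_upwards [ih, (h k).2] with N h₁ h₂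
    simp [outputs_succ, pre_succ, h₁, h₂]

theorem computable_outputs {T : List ℕ → ℕ → ℕ} (hT : Computable₂ T) :
    Computable₂ (outputs T) := by
  have happend : Computable₂ fun (a : ((List ℕ × ℕ) × (ℕ × Option (List ℕ))) × List ℕ) (v : ℕ) =>
      some (a.2 ++ [v]) :=
    (Computable.option_some.comp
      (Computable.list_concat.comp (Computable.snd.comp Computable.fst) Computable.snd)).to₂
  have hguess : Computable fun a : ((List ℕ × ℕ) × (ℕ × Option (List ℕ))) × List ℕ =>
      T a.1.1.1 a.1.2.1 :=
    hT.comp (Computable.fst.comp (Computable.fst.comp Computable.fst))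
      (Computable.fst.comp (Computable.snd.comp Computable.fst))
  have hstep := Computable.option_bind (α := (List ℕ × ℕ) × (ℕ × Option (List ℕ)))
    (f := fun c => c.2.2) (Computable.snd.comp Computable.snd)
    (Computable.nat_casesOn hguess (Computable.const none) happend).to₂
  exact (Computable.nat_rec (α := List ℕ × ℕ) (f := fun c => c.2) (g := fun _ => some [])
    Computable.snd (Computable.const _) hstep.to₂).to₂

/-- The answer of an associate to its `k`-th query for the `n`-th output, where the associate is
guessed by `S` and its input by `T`: `1` if it is not yet known, otherwise `0` or `v + 2` for the
entries `0` and `v + 1` of the associate. -/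
def answer (S T : List ℕ → ℕ → ℕ) (l : List ℕ) (n k : ℕ) : ℕ :=
  Nat.casesOn ((outputs T l k).elim 0 fun m => S l (Encodable.encode (n, m))) 1
    fun v => Nat.casesOn v 0 fun u => u + 2

theorem answer_cases {S T : List ℕ → ℕ → ℕ} {e p q : ℕ → ℕ} (hS : Tracks S e p)
    (hT : Tracks T e q) (N n k : ℕ) : answer S T (pre e N) n k = 1 ∨
      answer S T (pre e N) n k = Nat.casesOn (p (query q n k)) 0 fun u => u + 2 := by
  unfold answer
  rcases hT.outputs_cases N k with h | h
  · simp [h]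
  · rcases (hS (query q n k)).1 N with h' | h' <;> rw [query_eq] at h' ⊢ <;>
      simp only [h, Option.elim_some, h', or_true]
    exact Or.inl rfl

theorem eventually_answer {S T : List ℕ → ℕ → ℕ} {e p q : ℕ → ℕ} (hS : Tracks S e p)
    (hT : Tracks T e q) (n k : ℕ) : ∀ᶠ N in atTop,
      answer S T (pre e N) n k = Nat.casesOn (p (query q n k)) 0 fun u => u + 2 := by
  filter_upwards [hT.eventually_outputs k, (hS (query q n k)).2] with N h h'
  rw [query_eq] at h' ⊢
  simp only [answer, h, Option.elim_some, h']

theorem computable_answer {S T : List ℕ → ℕ → ℕ} (hS : Computable₂ S) (hT : Computable₂ T) :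
    Computable fun c : (List ℕ × ℕ) × ℕ => answer S T c.1.1 c.1.2 c.2 := by
  refine Computable.nat_casesOn (α := (List ℕ × ℕ) × ℕ) (h := fun _ v => Nat.casesOn v 0 fun u => u + 2)
    ?_ (Computable.const 1) ?_
  · have hl : Computable fun c : (List ℕ × ℕ) × ℕ => c.1.1 :=
      Computable.fst.comp Computable.fst
    refine (Computable.option_casesOn (g := fun c m => S c.1.1 (Encodable.encode (c.1.2, m)))
      ((computable_outputs hT).comp hl Computable.snd) (Computable.const 0) ?_).of_eq fun c => ?_
    · exact (hS.comp (hl.comp Computable.fst) (Computable.encode.comp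
        ((Computable.snd.comp (Computable.fst.comp Computable.fst)).pair Computable.snd))).to₂
    · cases outputs T c.1.1 c.2 <;> rfl
  · refine (Computable.nat_casesOn (h := fun _ u => u + 2) Computable.snd (Computable.const 0)
      ?_).to₂
    exact (Computable.succ.comp (Computable.succ.comp Computable.snd)).to₂

/-- If `S` guesses an associate and `T` guesses its input, then the output can be guessed. -/
theorem Tracks.app {S T : List ℕ → ℕ → ℕ} {e p q r : ℕ → ℕ} (hS : Tracks S e p)
    (hT : Tracks T e q) (h : Applies p q r) :
    Tracks (fun l n => (firstNonzero (answer S T l n) l.length).pred) e r := by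
  intro n
  obtain ⟨k, hk, hk0⟩ := h n
  simp only [length_pre]
  constructor
  · intro N
    rcases firstNonzero_cases (answer S T (pre e N) n) N with h | ⟨i, hi, hi0, h⟩
    · simp [h]
    · rw [h]
      -- The associate is read at its query `k`, and its later entries are arbitrary. An unknown
      -- answer counts as `1`, which stops the search and becomes the guess `0` under `Nat.pred`;
      -- hence the search never passes `k`.
      rcases lt_trichotomy i k with hik | rfl | hik
      · rcases answer_cases hS hT N n i with ha | ha
        · simp [ha]
        · rw [hk0 i hik] at ha
          exact absurd ha hi
      · rcases answer_cases hS hT N n i with ha | ha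
        · simp [ha]
        · rw [hk] at ha
          simp [ha]
      · have := hi0 k hik
        rcases answer_cases hS hT N n k with ha | ha
        · omega
        · rw [hk] at ha
          simp only at ha
          omega
  -- On a long prefix, all answers before query `k` are known to be `0` and the answer at `k` is `r
  -- n + 2`.
  · have h₁ : ∀ᶠ N in atTop, ∀ j ∈ Finset.range k, answer S T (pre e N) n j = 0 :=
      (Finset.eventually_all _).2 fun j hj =>
        (eventually_answer hS hT n j).mono fun N hN =>
          hN.trans (by rw [hk0 j (Finset.mem_range.1 hj)]; exact rfl)
    filter_upwards [h₁, eventually_answer hS hT n k, eventually_ge_atTop k] with N h₁ h₂ h₃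
    rw [hk] at h₂
    simp only at h₂
    rw [firstNonzero_eq (k := k) (by omega) (fun j hj => h₁ j (Finset.mem_range.2 hj)) h₃, h₂]
    rfl

theorem Comp.app {Φ Ψ : (ℕ → ℕ) → (ℕ → ℕ) → Prop} (hΦ : Comp Φ) (hΨ : Comp Ψ) :
    Comp fun e r => ∃ p q, Φ e p ∧ Ψ e q ∧ Applies p q r := by
  obtain ⟨S, hS, hSΦ⟩ := hΦ
  obtain ⟨T, hT, hTΨ⟩ := hΨ
  refine ⟨fun l n => (firstNonzero (answer S T l n) l.length).pred, ?_, ?_⟩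
  · exact (Computable.pred.comp (computable_firstNonzero (α := List ℕ × ℕ)
      (g := fun c k => answer S T c.1 c.2 k) (computable_answer hS hT).to₂
      (Computable.list_length.comp Computable.fst))).to₂
  · rintro e r ⟨p, q, hp, hq, h⟩
    exact (hSΦ e p hp).app (hTΨ e q hq) h

theorem Comp.comp {Φ : (ℕ → ℕ) → (ℕ → ℕ) → Prop} {F : (ℕ → ℕ) → ℕ → ℕ} (hF : CompFun F)
    (hΦ : Comp Φ) : Comp fun e r => ∃ p, Φ e p ∧ r = F p := by
  -- A computable associate is the value of a constant functional, so composition is a case of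
  -- application.
  obtain ⟨f, hf, hfF⟩ := hF.exists_associate
  refine ((compFun_const hf).app hΦ).mono ?_
  rintro e _ ⟨p, hp, rfl⟩
  exact ⟨f, p, rfl, hp, hfF p _ rfl⟩

theorem CompFun.comp {F G : (ℕ → ℕ) → ℕ → ℕ} (hF : CompFun F) (hG : CompFun G) :
    CompFun fun e => F (G e) :=
  (Comp.comp hF hG).mono fun e _ h => ⟨G e, rfl, h⟩

theorem CompFun.pair {F G : (ℕ → ℕ) → ℕ → ℕ} (hF : CompFun F) (hG : CompFun G) :
    CompFun fun e => pairSeq (F e) (G e) :=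
  (Comp.pair hF hG).mono fun e _ h => ⟨F e, G e, rfl, rfl, h⟩

theorem CompFun.app {F G : (ℕ → ℕ) → ℕ → ℕ} (hF : CompFun F) (hG : CompFun G) :
    Comp fun e r => Applies (F e) (G e) r :=
  (Comp.app hF hG).mono fun e _ h => ⟨F e, G e, rfl, rfl, h⟩

/-! ### Abstraction -/

/-- Two lists of length `k`, interleaved. -/
def interleave (l m : List ℕ) (k : ℕ) : List ℕ :=
  (List.range (2 * k)).map fun i => bif decide (i % 2 = 0) then l.getD (i / 2) 0 else m.getD (i / 2) 0

theorem interleave_pre (p q : ℕ → ℕ) {N k : ℕ} (h : k ≤ N) :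
    interleave (pre p N) (pre q k) k = pre (pairSeq p q) (2 * k) := by
  refine List.map_congr_left fun i hi => ?_
  have hi := List.mem_range.1 hi
  rw [getD_pre p (by omega : i / 2 < N), getD_pre q (by omega : i / 2 < k)]
  by_cases h : i % 2 = 0 <;> simp [pairSeq, h]

theorem computable_interleave :
    Computable fun c : (List ℕ × List ℕ) × ℕ => interleave c.1.1 c.1.2 c.2 := by
  refine Primrec.to_comp (Primrec.list_map (Primrec.list_range.comp
    (Primrec.nat_double.comp Primrec.snd)) ?_)
  have hi : Primrec fun a : ((List ℕ × List ℕ) × ℕ) × ℕ => a.2 / 2 :=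
    Primrec.nat_div.comp Primrec.snd (Primrec.const 2)
  have he : Primrec fun a : ((List ℕ × List ℕ) × ℕ) × ℕ => decide (a.2 % 2 = 0) :=
    ((Primrec.eq (α := ℕ)).comp (Primrec.nat_mod.comp Primrec.snd (Primrec.const 2))
      (Primrec.const 0)).decide
  exact (Primrec.cond he
    ((Primrec.list_getD 0).comp (Primrec.fst.comp (Primrec.fst.comp Primrec.fst)) hi)
    ((Primrec.list_getD 0).comp (Primrec.snd.comp (Primrec.fst.comp Primrec.fst)) hi)).to₂

/-- The guesses at the entry at `a` of the associate of the partial evaluation of a functional. -/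
def curryGuess (T : List ℕ → ℕ → ℕ) (l : List ℕ) (a : ℕ) : ℕ :=
  (Encodable.decode (α := ℕ × List ℕ) a).elim 1 fun c =>
    bif decide (c.2.length ≤ l.length) then T (interleave l c.2 c.2.length) c.1 + 1 else 0

/-- The associate of the partial evaluation at `e` of a functional. -/
def curry (T : List ℕ → ℕ → ℕ) (e : ℕ → ℕ) (a : ℕ) : ℕ :=
  (Encodable.decode (α := ℕ × List ℕ) a).elim 0 fun c =>
    T (interleave (pre e c.2.length) c.2 c.2.length) c.1

theorem interleave_pre_left (e : ℕ → ℕ) (m : List ℕ) {N : ℕ} (h : m.length ≤ N) :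
    interleave (pre e N) m m.length = interleave (pre e m.length) m m.length := by
  refine List.map_congr_left fun i hi => ?_
  have hi := List.mem_range.1 hi
  rw [getD_pre e (by omega : i / 2 < N), getD_pre e (by omega : i / 2 < m.length)]

/-- An entry for an input prefix `m` needs only `m.length` values of `e`, so it is known as soon as
that many are available. Guesses are shifted by one, hence `1` is the guess for the entry `0` where
nothing is decoded. -/
theorem tracks_curryGuess (T : List ℕ → ℕ → ℕ) (e : ℕ → ℕ) :
    Tracks (curryGuess T) e (curry T e) := by
  intro a
  unfold curryGuess curry
  rcases (Encodable.decode a : Option (ℕ × List ℕ)) with _ | c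
  · simp
  · have h : ∀ k ≥ c.2.length, (bif decide (c.2.length ≤ (pre e k).length) then
        T (interleave (pre e k) c.2 c.2.length) c.1 + 1 else 0) =
        T (interleave (pre e c.2.length) c.2 c.2.length) c.1 + 1 := fun k hk => by
      rw [interleave_pre_left e c.2 hk]
      simp [hk]
    refine ⟨fun k => ?_, eventually_atTop.2 ⟨_, h⟩⟩
    by_cases hk : c.2.length ≤ k
    · exact Or.inr (h k hk)
    · left
      simp [hk]

theorem computable_curryGuess {T : List ℕ → ℕ → ℕ} (hT : Computable₂ T) :
    Computable₂ (curryGuess T) := by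
  refine (Computable.option_casesOn (α := List ℕ × ℕ) (o := fun d => Encodable.decode d.2)
    (g := fun d (c : ℕ × List ℕ) => bif decide (c.2.length ≤ d.1.length) then
      T (interleave d.1 c.2 c.2.length) c.1 + 1 else 0) (Computable.decode.comp Computable.snd)
    (Computable.const 1) ?_).of_eq fun d => ?_
  · have hl : Computable fun x : (List ℕ × ℕ) × (ℕ × List ℕ) => x.1.1 :=
      Computable.fst.comp Computable.fst
    have hd : Computable fun y : ℕ × ℕ => decide (y.1 ≤ y.2) := Primrec.nat_le.decide.to_comp
    have hm : Computable fun x : (List ℕ × ℕ) × (ℕ × List ℕ) => x.2.2 :=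
      Computable.snd.comp Computable.snd
    have hn := Computable.list_length.comp hm
    have hc := hd.comp (hn.pair (Computable.list_length.comp hl))
    have hT' := hT.comp (computable_interleave.comp ((hl.pair hm).pair hn))
      (Computable.fst.comp Computable.snd)
    exact (Computable.cond hc (Computable.succ.comp hT') (Computable.const 0)).to₂
  · unfold curryGuess
    cases (Encodable.decode d.2 : Option (ℕ × List ℕ)) <;> rfl

/-- The curried associate consults `T` on the prefixes of even length of the interleaved input,
which are cofinal among all prefixes. -/
theorem Tracks.applies_curry {T : List ℕ → ℕ → ℕ} {e q r : ℕ → ℕ}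
    (h : Tracks T (pairSeq e q) r) : Applies (curry T e) q r := by
  intro n
  have hc : ∀ k, curry T e (query q n k) = T (pre (pairSeq e q) (2 * k)) n := fun k => by
    have := interleave_pre e q (le_refl k)
    simp only [pre] at this
    simp [curry, query, pre, this]
  refine outputsAt_of_first (fun k => hc k ▸ (h n).1 _) ?_
  obtain ⟨K, hK⟩ := eventually_atTop.1 (h n).2
  exact ⟨K, by rw [hc, hK _ (by omega)]⟩

theorem Comp.abs {Φ : (ℕ → ℕ) → (ℕ → ℕ) → Prop} (h : Comp Φ) :
    ∃ G, CompFun G ∧ ∀ e q r, Φ (pairSeq e q) r → Applies (G e) q r := by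
  obtain ⟨T, hT, hΦ⟩ := h
  refine ⟨curry T, ⟨curryGuess T, computable_curryGuess hT, ?_⟩, fun e q r her =>
    (hΦ _ _ her).applies_curry⟩
  rintro e _ rfl
  exact tracks_curryGuess T e

/-! ### Combinators -/

/-- The term `λ q, q p`. It names the saturation and the closure of a point, and realizes the
neighborhood, box and diamond maps. -/
theorem exists_eval : ∃ E, CompFun E ∧ ∀ p q r, Applies q p r → Applies (E p) q r := by
  obtain ⟨E, hE, h⟩ := (compFun_snd.app compFun_fst).abs
  exact ⟨E, hE, fun p q r hr => h p q r (by simpa using hr)⟩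

/-- A functional that evaluates its second argument at its first argument. -/
noncomputable def evalAt : (ℕ → ℕ) → ℕ → ℕ := exists_eval.choose

theorem compFun_evalAt : CompFun evalAt := exists_eval.choose_spec.1

theorem applies_evalAt {p q r : ℕ → ℕ} (h : Applies q p r) : Applies (evalAt p) q r :=
  exists_eval.choose_spec.2 p q r h

/-- The term `λ x, p (λ q, q x)`. It recovers an open set from its box, and it computes compact
unions and compact intersections. -/
theorem exists_compEval : ∃ G, CompFun G ∧
    ∀ p x r, Applies p (evalAt x) r → Applies (G p) x r := by
  obtain ⟨G, hG, h⟩ := (compFun_fst.app (compFun_evalAt.comp compFun_snd)).abs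
  exact ⟨G, hG, fun p x r hr => h p x r (by simpa using hr)⟩

/-- The composition of a functional with `evalAt`. -/
noncomputable def compEval : (ℕ → ℕ) → ℕ → ℕ := exists_compEval.choose

theorem compFun_compEval : CompFun compEval := exists_compEval.choose_spec.1

theorem applies_compEval {p x r : ℕ → ℕ} (h : Applies p (evalAt x) r) :
    Applies (compEval p) x r :=
  exists_compEval.choose_spec.2 p x r h

theorem exists_compose : ∃ B, CompFun B ∧
    ∀ f u x y r, Applies f x y → Applies u y r → Applies (B (pairSeq f u)) x r := by
  obtain ⟨B, hB, h⟩ := (Comp.app (compFun_snd.comp compFun_fst)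
    ((compFun_fst.comp compFun_fst).app compFun_snd)).abs
  exact ⟨B, hB, fun f u x y r hy hr => h _ x r ⟨u, y, by simp, by simpa using hy, hr⟩⟩

/-- `compose ⟨f, u⟩` is an associate of the composition of the functionals with associates `f` and
`u`. -/
noncomputable def compose : (ℕ → ℕ) → ℕ → ℕ := exists_compose.choose

theorem compFun_compose : CompFun compose := exists_compose.choose_spec.1

theorem applies_compose {f u x y r : ℕ → ℕ} (hf : Applies f x y) (hu : Applies u y r) :
    Applies (compose (pairSeq f u)) x r :=
  exists_compose.choose_spec.2 f u x y r hf hu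

/-! ### Open sets and names -/

/-- A nonzero output of the realizer depends on a finite prefix of the input. No computability is
needed, so any name provides openness. -/
theorem isOpen_of_realizes {X : Type u} [RepresentedSpace X] {S : Set X} {p : ℕ → ℕ}
    (hp : Realizes p (charFun S)) : IsOpen[finalTopology X] S := by
  rw [isOpen_final_iff]
  intro q x hq hx
  obtain ⟨r, hr, hrx⟩ := hp q x hq
  obtain ⟨n, hn⟩ := (show x ∈ S ↔ ∃ n, r n ≠ 0 from hrx).1 hx
  obtain ⟨m, hm⟩ := (hr n).finite
  refine ⟨m, fun q' x' hq' h => ?_⟩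
  obtain ⟨r', hr', hrx'⟩ := hp q' x' hq'
  refine (show x' ∈ S ↔ ∃ n, r' n ≠ 0 from hrx').2 ⟨n, ?_⟩
  rwa [(hr' n).unique (hm p q' (fun _ _ => rfl) h)]

theorem names_sierpinski_congr {r : ℕ → ℕ} {s t : Prop} (h : Names (X := Sierpinski) r s)
    (hst : s ↔ t) : Names (X := Sierpinski) r t :=
  propext hst ▸ h

/-- A map into the power set of `Z` embeds `X` into `𝒪(Z)` if names of its values can be computed
from names of its arguments and vice versa. -/
theorem embedsInOpens_of_compFun {X : Type u} {Z : Type v} [RepresentedSpace X]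
    [RepresentedSpace Z] {f : X → Set Z} {F G : (ℕ → ℕ) → ℕ → ℕ} (hF : CompFun F)
    (hFf : ∀ p x, Names p x → Realizes (F p) (charFun (f x))) (hG : CompFun G)
    (hGf : ∀ q x, Realizes q (charFun (f x)) → Names (G q) x) : EmbedsInOpens f := by
  have hopen : ∀ x, IsOpen[finalTopology Z] (f x) := fun x => by
    obtain ⟨p, hp⟩ := RepresentedSpace.surj x
    exact isOpen_of_realizes (hFf p x hp)
  obtain ⟨a, ha, haF⟩ := hF.exists_associate
  obtain ⟨b, hb, hbG⟩ := hG.exists_associate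
  refine ⟨hopen, fun x y hxy => ?_, ⟨a, ha, fun q x hq => ⟨F q, haF q _ rfl, hFf q x hq⟩⟩,
    ⟨b, hb, fun q x hq => ⟨G q, hbG q _ rfl, hGf q x hq⟩⟩⟩
  -- Injectivity comes from decoding: if the values agree, `G (F p)` names both points.
  obtain ⟨p, hp⟩ := RepresentedSpace.surj x
  have hfxy : f x = f y := congrArg Subtype.val hxy
  exact RepresentedSpace.unique (hGf _ x (hFf p x hp)) (hGf _ y (hfxy ▸ hFf p x hp))

theorem names_opens_applies {X : Type u} [RepresentedSpace X] {p q : ℕ → ℕ} {U : Opens X} {x : X}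
    (hp : Names p U) (hq : Names q x) :
    ∃ r, Applies p q r ∧ Names (X := Sierpinski) r (x ∈ U.1) :=
  hp q x hq

theorem names_compactSets_applies {X : Type u} [RepresentedSpace X] {p q : ℕ → ℕ}
    {K : CompactSets X} {U : Opens X} (hp : Names p K) (hq : Names q U) :
    ∃ r, Applies p q r ∧ Names (X := Sierpinski) r (K.1 ⊆ U.1) :=
  hp q U hq

theorem names_closedSets_applies {X : Type u} [RepresentedSpace X] {p q : ℕ → ℕ}
    {A : ClosedSets X} {U : Opens X} (hp : Names p A) (hq : Names q U) :
    ∃ r, Applies p q r ∧ Names (X := Sierpinski) r (A.1 ∩ U.1).Nonempty :=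
  hp q U hq

/-- The saturation of a compact set. -/
def CompactSets.saturation {X : Type u} [RepresentedSpace X] (S : Set X)
    (hS : @IsCompact X (finalTopology X) S) : CompactSets X :=
  ⟨⋂₀ {U | IsOpen[finalTopology X] U ∧ S ⊆ U}, by
    let _ := finalTopology X
    refine ⟨isCompact_of_finite_subcover fun {ι} V hV hSV => ?_, ?_⟩
    · have hsub : S ⊆ ⋂₀ {U | IsOpen[finalTopology X] U ∧ S ⊆ U} :=
        Set.subset_sInter fun U hU => hU.2
      obtain ⟨t, ht⟩ := hS.elim_finite_subcover V hV (hsub.trans hSV)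
      -- The union of a finite subcover of `S` is itself one of the open sets that are intersected.
      exact ⟨t, Set.sInter_subset_of_mem ⟨isOpen_biUnion fun i _ => hV i, ht⟩⟩
    · refine Set.Subset.antisymm (Set.subset_sInter fun U hU => hU.2)
        (Set.sInter_subset_sInter fun U hU => ?_)
      exact ⟨hU.1, Set.sInter_subset_of_mem hU⟩⟩

/-- A set and its saturation have the same open supersets, so names cannot distinguish them. -/
theorem CompactSets.saturation_subset_iff {X : Type u} [RepresentedSpace X] {S : Set X}
    (hS : @IsCompact X (finalTopology X) S) (U : Opens X) :
    (CompactSets.saturation S hS).1 ⊆ U.1 ↔ S ⊆ U.1 :=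
  ⟨(Set.subset_sInter fun _ hV => hV.2).trans, fun h => Set.sInter_subset_of_mem ⟨U.2, h⟩⟩

/-- The saturation of a point. -/
def CompactSets.point {X : Type u} [RepresentedSpace X] (x : X) : CompactSets X :=
  CompactSets.saturation {x} (@isCompact_singleton X (finalTopology X) x)

theorem CompactSets.point_subset_iff {X : Type u} [RepresentedSpace X] (x : X) (U : Opens X) :
    (CompactSets.point x).1 ⊆ U.1 ↔ x ∈ U.1 :=
  (CompactSets.saturation_subset_iff _ U).trans Set.singleton_subset_iff

theorem names_point {X : Type u} [RepresentedSpace X] {p : ℕ → ℕ} {x : X} (hp : Names p x) :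
    Names (evalAt p) (CompactSets.point x) := by
  intro q U hq
  obtain ⟨r, hr, hrx⟩ := names_opens_applies hq hp
  exact ⟨r, applies_evalAt hr,
    names_sierpinski_congr hrx (CompactSets.point_subset_iff x U).symm⟩

/-- The closure of a point. -/
def ClosedSets.point {X : Type u} [RepresentedSpace X] (x : X) : ClosedSets X :=
  ⟨@closure X (finalTopology X) {x}, @isClosed_closure X (finalTopology X) _⟩

theorem ClosedSets.point_inter_nonempty_iff {X : Type u} [RepresentedSpace X] (x : X) {U : Set X}
    (hU : IsOpen[finalTopology X] U) : ((ClosedSets.point x).1 ∩ U).Nonempty ↔ x ∈ U := by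
  let _ := finalTopology X
  exact (closure_inter_open_nonempty_iff hU).trans (by simp)

theorem names_closure_point {X : Type u} [RepresentedSpace X] {p : ℕ → ℕ} {x : X}
    (hp : Names p x) : Names (evalAt p) (ClosedSets.point x) := by
  intro q U hq
  obtain ⟨r, hr, hrx⟩ := names_opens_applies hq hp
  exact ⟨r, applies_evalAt hr,
    names_sierpinski_congr hrx (ClosedSets.point_inter_nonempty_iff x U.2).symm⟩

/-! ### Box and diamond -/

theorem realizes_boxMap {X : Type u} [RepresentedSpace X] {p : ℕ → ℕ} {U : Opens X}
    (hp : Names p U) : Realizes (evalAt p) (charFun (boxMap X U)) := by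
  intro q K hq
  obtain ⟨r, hr, hrK⟩ := names_compactSets_applies hq hp
  exact ⟨r, applies_evalAt hr, hrK⟩

theorem realizes_diamondMap {X : Type u} [RepresentedSpace X] {p : ℕ → ℕ} {U : Opens X}
    (hp : Names p U) : Realizes (evalAt p) (charFun (diamondMap X U)) := by
  intro q A hq
  obtain ⟨r, hr, hrA⟩ := names_closedSets_applies hq hp
  exact ⟨r, applies_evalAt hr, hrA⟩

theorem isOpen_boxMap {X : Type u} [RepresentedSpace X] (U : Opens X) :
    IsOpen[finalTopology (CompactSets X)] (boxMap X U) := by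
  obtain ⟨p, hp⟩ := RepresentedSpace.surj U
  exact isOpen_of_realizes (realizes_boxMap hp)

theorem isOpen_diamondMap {X : Type u} [RepresentedSpace X] (U : Opens X) :
    IsOpen[finalTopology (ClosedSets X)] (diamondMap X U) := by
  obtain ⟨p, hp⟩ := RepresentedSpace.surj U
  exact isOpen_of_realizes (realizes_diamondMap hp)

theorem isOpen_nhdMap {X : Type u} [RepresentedSpace X] (x : X) :
    IsOpen[finalTopology (Opens X)] (nhdMap X x) := by
  convert isOpen_traceSet {x} using 1
  ext U
  exact (Set.singleton_inter_nonempty (s := U.1)).symm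

theorem realizes_nhdMap {X : Type u} [RepresentedSpace X] {p : ℕ → ℕ} {x : X}
    (hp : Names p x) : Realizes (evalAt p) (charFun (nhdMap X x)) := by
  intro q U hq
  obtain ⟨r, hr, hrU⟩ := names_opens_applies hq hp
  exact ⟨r, applies_evalAt hr, hrU⟩

/-- The transpose is the identity of `𝒪(X)`; for box and diamond below it is the defining embedding
of the hyperspace into `𝒪𝒪(X)`. -/
theorem isComputablePresubbase_nhdMap (X : Type u) [RepresentedSpace X] :
    IsComputablePresubbase (nhdMap X) :=
  ⟨isOpen_nhdMap, embedsInOpens_of_compFun compFun_id (fun _ _ hp => hp) compFun_id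
    fun _ _ hq => hq⟩

theorem isComputablePresubbase_boxMap (X : Type u) [RepresentedSpace X] :
    IsComputablePresubbase (boxMap X) :=
  ⟨isOpen_boxMap, embedsInOpens_of_compFun compFun_id (fun _ _ hp => hp) compFun_id
    fun _ _ hq => hq⟩

theorem isComputablePresubbase_diamondMap (X : Type u) [RepresentedSpace X] :
    IsComputablePresubbase (diamondMap X) :=
  ⟨isOpen_diamondMap, embedsInOpens_of_compFun compFun_id (fun _ _ hp => hp) compFun_id
    fun _ _ hq => hq⟩

theorem isComputablePresubbase_filterMap (X : Type u) [RepresentedSpace X] :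
    IsComputablePresubbase (filterMap X) := by
  refine ⟨fun K => isOpen_filterSet K.2.1, embedsInOpens_of_compFun compFun_evalAt
    (fun _ _ hp => realizes_boxMap hp) compFun_compEval fun q U hq x z hx => ?_⟩
  obtain ⟨r, hr, hrx⟩ := hq _ _ (names_point hx)
  exact ⟨r, applies_compEval hr, names_sierpinski_congr hrx (CompactSets.point_subset_iff z U)⟩

/-! ### Compact unions and intersections -/

/-- Each member of `𝒦` is covered by some finite subfamily `t`, hence lies in the open box of `W t`.
These boxes are directed, so compactness of `𝒦` yields one `t` for all members. -/
theorem isCompact_biUnion {X : Type u} [RepresentedSpace X] (𝒦 : CompactSets (CompactSets X)) :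
    @IsCompact X (finalTopology X) (⋃ K ∈ 𝒦.1, K.1) := by
  let _ := finalTopology X
  let _ := finalTopology (CompactSets X)
  refine isCompact_of_finite_subcover fun {ι} V hV hcov => ?_
  let W : Finset ι → Opens X := fun t => ⟨⋃ i ∈ t, V i, isOpen_biUnion fun i _ => hV i⟩
  have hmono : Monotone fun t => boxMap X (W t) := fun s t hst K hK =>
    hK.trans (Set.biUnion_subset_biUnion_left hst)
  have hsub : 𝒦.1 ⊆ ⋃ t, boxMap X (W t) := fun K hK => by
    obtain ⟨t, ht⟩ := K.2.1.elim_finite_subcover V hV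
      ((Set.subset_biUnion_of_mem (u := fun K : CompactSets X => K.1) hK).trans hcov)
    exact Set.mem_iUnion.2 ⟨t, ht⟩
  obtain ⟨t, ht⟩ := 𝒦.2.1.elim_directed_cover _ (fun t => isOpen_boxMap (W t)) hsub
    hmono.directed_le
  exact ⟨t, Set.iUnion₂_subset fun K hK => ht hK⟩

/-- The saturation of a compact union of compact sets. -/
def CompactSets.union {X : Type u} [RepresentedSpace X] (𝒦 : CompactSets (CompactSets X)) :
    CompactSets X :=
  CompactSets.saturation _ (isCompact_biUnion 𝒦)

theorem CompactSets.union_subset_iff {X : Type u} [RepresentedSpace X]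
    (𝒦 : CompactSets (CompactSets X)) (U : Opens X) :
    (CompactSets.union 𝒦).1 ⊆ U.1 ↔ 𝒦.1 ⊆ boxMap X U :=
  (CompactSets.saturation_subset_iff _ U).trans Set.iUnion₂_subset_iff

theorem names_union {X : Type u} [RepresentedSpace X] {p : ℕ → ℕ}
    {𝒦 : CompactSets (CompactSets X)} (hp : Names p 𝒦) :
    Names (compEval p) (CompactSets.union 𝒦) := by
  intro q U hq
  have hbox : Names (X := Opens (CompactSets X)) (evalAt q) ⟨boxMap X U, isOpen_boxMap U⟩ :=
    realizes_boxMap hq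
  obtain ⟨r, hr, hrU⟩ := names_compactSets_applies hp hbox
  exact ⟨r, applies_compEval hr,
    names_sierpinski_congr hrU (CompactSets.union_subset_iff 𝒦 U).symm⟩

/-- A point lies in all members of `𝒰` iff `𝒰` is contained in its open neighborhood filter, which a
name of `𝒰` can test. -/
theorem realizes_biInter {X : Type u} [RepresentedSpace X] {p : ℕ → ℕ}
    {𝒰 : CompactSets (Opens X)} (hp : Names p 𝒰) :
    Realizes (compEval p) (charFun (⋂ U ∈ 𝒰.1, U.1)) := by
  intro q x hq
  have hnhd : Names (X := Opens (Opens X)) (evalAt q) ⟨nhdMap X x, isOpen_nhdMap x⟩ :=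
    realizes_nhdMap hq
  obtain ⟨r, hr, hrx⟩ := names_compactSets_applies hp hnhd
  exact ⟨r, applies_compEval hr, names_sierpinski_congr hrx Set.mem_iInter₂.symm⟩

/-- The intersection of a compact set of open sets. -/
def Opens.inter {X : Type u} [RepresentedSpace X] (𝒰 : CompactSets (Opens X)) : Opens X :=
  ⟨⋂ U ∈ 𝒰.1, U.1, by
    obtain ⟨p, hp⟩ := RepresentedSpace.surj 𝒰
    exact isOpen_of_realizes (realizes_biInter hp)⟩

/-- A presubbase is a prebase if its compact intersections are computably among its members. -/
theorem IsComputablePresubbase.isComputablePrebase {X : Type u} {Z : Type v} [RepresentedSpace X]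
    [RepresentedSpace Z] {B : Z → Set X} (hB : IsComputablePresubbase B) (m : CompactSets Z → Z)
    {F : (ℕ → ℕ) → ℕ → ℕ} (hF : CompFun F) (hFm : ∀ p K, Names p K → Names (F p) (m K))
    (hm : ∀ K, ⋂ z ∈ K.1, B z = B (m K)) (huniv : ⋃ z, B z = Set.univ) :
    IsComputablePrebase B := by
  refine ⟨hB, ⟨fun K => {ClosedSets.point (m K)}, ?_, ?_⟩, huniv⟩
  · obtain ⟨a, ha, haF⟩ := (compFun_evalAt.comp hF).exists_associate
    exact ⟨a, ha, fun q K hq => ⟨_, haF q _ rfl, _, rfl, names_closure_point (hFm q K hq)⟩⟩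
  · rintro K _ rfl
    rw [hm]
    ext x
    -- The indices `z` with `x ∈ B z` form an open set, which meets the closure of a point only if
    -- it contains that point.
    refine (ClosedSets.point_inter_nonempty_iff (m K) (hB.2.1 x)).symm.trans ?_
    simp only [Set.mem_iUnion, exists_prop]
    rfl

theorem isComputablePrebase_filterMap (X : Type u) [RepresentedSpace X] :
    IsComputablePrebase (filterMap X) := by
  refine (isComputablePresubbase_filterMap X).isComputablePrebase CompactSets.union
    compFun_compEval (fun _ _ => names_union) (fun 𝒦 => ?_) ?_
  · ext U
    exact Set.mem_iInter₂.trans (CompactSets.union_subset_iff 𝒦 U).symm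
  -- The empty compact set is below every open set.
  · let _ := finalTopology X
    refine Set.eq_univ_of_forall fun U => Set.mem_iUnion.2
      ⟨CompactSets.saturation ∅ isCompact_empty, ?_⟩
    exact (CompactSets.saturation_subset_iff _ U).2 (Set.empty_subset _)

theorem isComputablePrebase_boxMap (X : Type u) [RepresentedSpace X] :
    IsComputablePrebase (boxMap X) := by
  refine (isComputablePresubbase_boxMap X).isComputablePrebase Opens.inter
    compFun_compEval (fun _ _ => realizes_biInter) (fun 𝒰 => ?_) ?_
  · ext K
    exact Set.mem_iInter₂.trans Set.subset_iInter₂_iff.symm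
  · let _ := finalTopology X
    exact Set.eq_univ_of_forall fun K => Set.mem_iUnion.2
      ⟨⟨Set.univ, isOpen_univ⟩, Set.subset_univ K.1⟩

/-! ### Function spaces -/

theorem realizes_preimage {X : Type u} {Y : Type v} [RepresentedSpace X] [RepresentedSpace Y]
    {p q : ℕ → ℕ} {f : ContFun X Y} {U : Opens Y} (hp : Names p f) (hq : Names q U) :
    Realizes (compose (pairSeq p q)) (charFun (f.1 ⁻¹' U.1)) := by
  intro x z hx
  obtain ⟨y, hy, hyf⟩ := hp x z hx
  obtain ⟨r, hr, hrU⟩ := names_opens_applies hq hyf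
  exact ⟨r, applies_compose hy hr, hrU⟩

/-- The preimage of an open set under a continuous map. -/
def ContFun.preimage {X : Type u} {Y : Type v} [RepresentedSpace X] [RepresentedSpace Y]
    (f : ContFun X Y) (U : Opens Y) : Opens X :=
  ⟨f.1 ⁻¹' U.1, by
    obtain ⟨p, hp⟩ := RepresentedSpace.surj f
    obtain ⟨q, hq⟩ := RepresentedSpace.surj U
    exact isOpen_of_realizes (realizes_preimage hp hq)⟩

theorem comp_mapsTo : Comp fun e r =>
    Applies (fstSeq (sndSeq e)) (compose (pairSeq (fstSeq e) (sndSeq (sndSeq e)))) r :=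
  (compFun_fst.comp compFun_snd).app
    (compFun_compose.comp (compFun_fst.pair (compFun_snd.comp compFun_snd)))

theorem applies_mapsTo {X : Type u} {Y : Type v} [RepresentedSpace X] [RepresentedSpace Y]
    {p q : ℕ → ℕ} {f : ContFun X Y} {z : CompactSets X × Opens Y} (hp : Names p f)
    (hq : Names q z) : ∃ r, Applies (fstSeq q) (compose (pairSeq p (sndSeq q))) r ∧
      Names (X := Sierpinski) r (f.1 '' z.1.1 ⊆ z.2.1) := by
  have hpre : Names (compose (pairSeq p (sndSeq q))) (f.preimage z.2) :=
    realizes_preimage hp hq.2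
  obtain ⟨r, hr, hrK⟩ := names_compactSets_applies hq.1 hpre
  exact ⟨r, hr, names_sierpinski_congr hrK Set.image_subset_iff.symm⟩

theorem isOpen_compactOpenMap {X : Type u} {Y : Type v} [RepresentedSpace X] [RepresentedSpace Y]
    (z : CompactSets X × Opens Y) : IsOpen[finalTopology (ContFun X Y)] (compactOpenMap X Y z) := by
  obtain ⟨q, hq⟩ := RepresentedSpace.surj z
  -- Here the name of `z` is the parameter and the name of `f` the argument; only continuity
  -- matters, so computability of `G` is dropped.
  have hswap : Comp fun e r =>
      Applies (fstSeq (fstSeq e)) (compose (pairSeq (sndSeq e) (sndSeq (fstSeq e)))) r :=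
    (compFun_fst.comp compFun_fst).app
      (compFun_compose.comp (compFun_snd.pair (compFun_snd.comp compFun_fst)))
  obtain ⟨G, -, hG⟩ := hswap.abs
  refine isOpen_of_realizes (p := G q) fun p f hp => ?_
  obtain ⟨r, hr, hrf⟩ := applies_mapsTo hp hq
  exact ⟨r, hG q p r (by simpa using hr), hrf⟩

/-- The term `λ u, w (λ q, q x, u)`: it tests an open set `U` of `Y` on the saturation of the point
named by `x`. -/
theorem exists_pointOpen : ∃ D, CompFun D ∧ ∀ w x u r,
    Applies w (pairSeq (evalAt x) u) r → Applies (D (pairSeq w x)) u r := by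
  obtain ⟨D, hD, h⟩ := ((compFun_fst.comp compFun_fst).app
    ((compFun_evalAt.comp (compFun_snd.comp compFun_fst)).pair compFun_snd)).abs
  exact ⟨D, hD, fun w x u r hr => h _ u r (by simpa using hr)⟩

theorem isComputablePresubbase_compactOpenMap (X : Type u) (Y : Type v) [RepresentedSpace X]
    [RepresentedSpace Y] (hY : IsComputableKolmogorov Y) :
    IsComputablePresubbase (compactOpenMap X Y) := by
  obtain ⟨H, hH, hHr⟩ := comp_mapsTo.abs
  obtain ⟨D, hD, hDr⟩ := exists_pointOpen
  obtain ⟨_, _, _, k, hk, hkY⟩ := hY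
  -- `J w` maps `x` to the point that the Kolmogorov decoder `k` extracts from the neighborhood
  -- filter `D (pairSeq w x)`.
  obtain ⟨J, hJ, hJr⟩ := ((compFun_const hk).app hD).abs
  refine ⟨isOpen_compactOpenMap, embedsInOpens_of_compFun hH (fun p f hp q z hq => ?_) hJ
    fun w f hw x z hx => ?_⟩
  · obtain ⟨r, hr, hrf⟩ := applies_mapsTo hp hq
    exact ⟨r, hHr p q r (by simpa using hr), hrf⟩
  · have hnhd : Realizes (D (pairSeq w x)) (charFun (nhdMap Y (f.1 z))) := by
      intro u U hu
      have hpair : Names (pairSeq (evalAt x) u) (CompactSets.point z, U) := by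
        refine ⟨?_, ?_⟩
        · change Names (fstSeq (pairSeq (evalAt x) u)) _
          rw [fstSeq_pairSeq]
          exact names_point hx
        · change Names (sndSeq (pairSeq (evalAt x) u)) _
          rwa [sndSeq_pairSeq]
      obtain ⟨r, hr, hrU⟩ := hw _ _ hpair
      refine ⟨r, hDr w x u r hr, names_sierpinski_congr hrU ?_⟩
      exact Set.image_subset_iff.trans (CompactSets.point_subset_iff z (f.preimage U))
    obtain ⟨r, hr, hrf⟩ := hkY _ (f.1 z) hnhd
    exact ⟨r, hJr w x r hr, hrf⟩

end TTE

theorem proposition26 {X : Type*} {Y : Type*} [RepresentedSpace X] [RepresentedSpace Y]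
    (hY : IsComputableKolmogorov Y) :
    (IsComputablePresubbase (nhdMap X) ∧
      IsComputablePresubbase (filterMap X) ∧
      IsComputablePresubbase (boxMap X) ∧
      IsComputablePresubbase (diamondMap X) ∧
      IsComputablePresubbase (compactOpenMap X Y)) ∧
    IsComputablePrebase (filterMap X) ∧
    IsComputablePrebase (boxMap X) :=
  ⟨⟨isComputablePresubbase_nhdMap X, isComputablePresubbase_filterMap X,
    isComputablePresubbase_boxMap X, isComputablePresubbase_diamondMap X,
    isComputablePresubbase_compactOpenMap X Y hY⟩,
    isComputablePrebase_filterMap X, isComputablePrebase_boxMap X⟩
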